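/- By a plane graph we mean a finite connected graph, loops and multiple edges allowed, embedded in the plane (equivalently, in the sphere); it is $4$-valent if every vertex has degree $4$. The size of a face is the length of its boundary walk, a face of size $k$ is called a $k$-gon, and $p_k$ is the number of $k$-gonal faces. An $i$-hedrite is a $4$-valent plane graph all of whose faces are $2$-, $3$- or $4$-gons and with $p_2=8-i$. A central circuit of a $4$-valent plane graph is a closed walk obtained by starting with an edge and continuing at each vertex by the edge opposite to the entering one (in the cyclic order of the four edge-ends there), until one returns to the starting edge in the starting direction; it self-intersects if it passes more than once through some vertex. **Proposition.** (i) In a $4$-valent plane graph all of whose faces have even size, no central circuit self-intersects. In particular, in a $4$-hedrite all faces have even size, and no central circuit self-intersects. (ii) In every $7$-hedrite at least one central circuit self-intersects. -/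

import Mathlib

/-- A combinatorial map (rotation system) on a set `D` of darts, i.e. of oriented edges: the
standard combinatorial form of a graph, with loops and multiple edges allowed, that is cellularly
embedded in an oriented closed surface.
`rot` sends a dart to the next dart, counterclockwise, with the same tail vertex;
`rev` sends a dart to the same edge with the opposite orientation. -/
structure CombMap (D : Type*) where
  rot : Equiv.Perm D
  rev : Equiv.Perm D
  rev_rev : ∀ d, rev (rev d) = d
  rev_ne : ∀ d, rev d ≠ d

namespace CombMap

variable {D : Type*} (M : CombMap D)

/-- Vertices are the cycles of `rot`. -/
def Vertex : Type _ := Quotient (Equiv.Perm.SameCycle.setoid M.rot)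

/-- Edges are the cycles of `rev`, i.e. the pairs `{d, rev d}`. -/
def Edge : Type _ := Quotient (Equiv.Perm.SameCycle.setoid M.rev)

/-- Walk along a dart to its head, then leave by the next dart clockwise after the one just used:
the step along the boundary walk of the face to the left of the dart. -/
def faceStep : Equiv.Perm D := M.rot⁻¹ * M.rev

/-- Faces are the cycles of `faceStep`. -/
def Face : Type _ := Quotient (Equiv.Perm.SameCycle.setoid M.faceStep)

/-- The vertex from which a dart starts. -/
def tail (d : D) : M.Vertex := Quotient.mk _ d

/-- The face to the left of a dart. -/
def left (d : D) : M.Face := Quotient.mk _ d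

/-- The degree (valency) of a vertex: the number of darts starting there; a loop counts twice. -/
noncomputable def degree (v : M.Vertex) : ℕ := {d : D | M.tail d = v}.ncard

/-- The size of a face, i.e. the length of its boundary walk: a face of size `k` is a `k`-gon. -/
noncomputable def faceSize (f : M.Face) : ℕ := {d : D | M.left d = f}.ncard

/-- `M.p k` is the number of `k`-gonal faces. -/
noncomputable def p (k : ℕ) : ℕ := Nat.card {f : M.Face // M.faceSize f = k}

/-- The underlying graph is connected: one gets from any dart to any other by the moves
`rot` and `rev` and their inverses. -/
def IsConnected : Prop :=
  MulAction.IsPretransitive (Subgroup.closure ({M.rot, M.rev} : Set (Equiv.Perm D))) D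

/-- `M` is a finite connected plane graph (with at least one edge): the surface in which it is
embedded is the sphere, i.e. is connected of Euler characteristic `2`. -/
structure IsPlane : Prop where
  finite : Finite D
  connected : M.IsConnected
  euler : (Nat.card M.Vertex : ℤ) - Nat.card M.Edge + Nat.card M.Face = 2

/-- Every vertex has degree `4`. -/
def IsFourValent : Prop := ∀ v : M.Vertex, M.degree v = 4

/-- Every face is a `k`-gon with `k` even. -/
def AllFacesEven : Prop := ∀ f : M.Face, Even (M.faceSize f)

/-- An `i`-hedrite is a 4-valent plane graph all of whose faces are 2-, 3- or 4-gons, with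
exactly `8 - i` of them 2-gons. -/
structure IsHedrite (i : ℕ) : Prop where
  plane : M.IsPlane
  fourValent : M.IsFourValent
  faceSize_mem : ∀ f : M.Face, M.faceSize f ∈ ({2, 3, 4} : Set ℕ)
  p_two : M.p 2 + i = 8

/-- The straight-ahead step in a 4-valent graph: walk along a dart to its head, then leave by the
edge opposite to the entering one, i.e. two places further in the rotation there. -/
def straightStep : Equiv.Perm D := M.rot * M.rot * M.rev

/-- Central circuits of a 4-valent graph, each taken with a direction of travel: the closed walks
obtained by starting with a dart and going straight ahead at each vertex until the starting dart
recurs. (Each undirected central circuit occurs here twice, once for either direction.) -/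
def CentralCircuit : Type _ := Quotient (Equiv.Perm.SameCycle.setoid M.straightStep)

/-- The directed central circuit that runs along a given dart. -/
def circuitOf (d : D) : M.CentralCircuit := Quotient.mk _ d

/-- A central circuit self-intersects if it passes more than once through some vertex: two
different darts of the (directed) circuit leave the same vertex. -/
def CentralCircuit.SelfIntersects {M : CombMap D} (C : M.CentralCircuit) : Prop :=
  ∃ d e : D, M.circuitOf d = C ∧ M.circuitOf e = C ∧ d ≠ e ∧ M.tail d = M.tail e

end CombMap

namespace Equiv.Perm

/-! Even faces: a self-intersecting circuit contains a stretch that leaves a vertex along `d` and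
returns so that going straight on would follow `M.rot d`. Let it have `N + 1` edges, hence `N`
straight passages. Modulo 2 its edges form a cycle, so on the sphere they bound a set of faces
(`IsPlane.exists_potential`). The sizes of these faces add up to an even number; edges off the
stretch contribute evenly and each edge of the stretch once, so `N + 1` is even. Counting the
off-stretch contributions around vertices instead, each straight passage gives 1 and the corner at
`d` gives 0, so `N` is even too: a contradiction (`circuitOf_rot_ne`). For 4-hedrites, Euler's
formula excludes triangles.

7-hedrites: if no circuit self-intersects, the prolongations of a digon edge in its two directions
are the rails of a ladder of faces starting beside the digon. Every face of the ladder must be a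
quadrilateral, so it never ends, yet finiteness brings it back to its start through the only digon
(`exists_selfIntersects_of_unique_digon`). -/

theorem ncard_sameCycle {D : Type*} [Finite D] (f : Equiv.Perm D) (d : D) :
    {e : D | (Quotient.mk (SameCycle.setoid f) e) = Quotient.mk _ d}.ncard =
      Function.minimalPeriod f d := by
  have h : {e : D | (Quotient.mk (SameCycle.setoid f) e) = Quotient.mk _ d} =
      MulAction.orbit (Subgroup.zpowers f) d := by
    ext e
    rw [Set.mem_ofPred_eq, Quotient.eq]
    constructor
    · intro he
      obtain ⟨i, hi⟩ := SameCycle.symm he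
      exact ⟨⟨f ^ i, i, rfl⟩, hi⟩
    · rintro ⟨⟨_, i, rfl⟩, hi⟩
      exact SameCycle.symm ⟨i, hi⟩
  have := Fintype.ofFinite (MulAction.orbit (Subgroup.zpowers f) d)
  have h2 := MulAction.minimalPeriod_eq_card (a := f) (b := d)
  rw [h, ← Nat.card_coe_set_eq, Nat.card_eq_fintype_card, ← h2]
  rfl

end Equiv.Perm

/-! ### Darts at a 4-valent vertex and straight walks -/

namespace CombMap

variable {D : Type*} {M : CombMap D}

theorem tail_rot (d : D) : M.tail (M.rot d) = M.tail d :=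
  Quotient.sound (Equiv.Perm.sameCycle_apply_left.2 (Equiv.Perm.SameCycle.refl _ _))

theorem tail_eq_iff {d e : D} : M.tail d = M.tail e ↔ M.rot.SameCycle d e := Quotient.eq

theorem left_eq_iff {d e : D} : M.left d = M.left e ↔ M.faceStep.SameCycle d e := Quotient.eq

theorem circuitOf_eq_iff {d e : D} :
    M.circuitOf d = M.circuitOf e ↔ M.straightStep.SameCycle d e := Quotient.eq

theorem left_faceStep (d : D) : M.left (M.faceStep d) = M.left d :=
  Quotient.sound (Equiv.Perm.sameCycle_apply_left.2 (Equiv.Perm.SameCycle.refl _ _))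

theorem circuitOf_straightStep (d : D) : M.circuitOf (M.straightStep d) = M.circuitOf d :=
  Quotient.sound (Equiv.Perm.sameCycle_apply_left.2 (Equiv.Perm.SameCycle.refl _ _))

theorem rot_faceStep (d : D) : M.rot (M.faceStep d) = M.rev d := by
  simp [faceStep]

theorem straightStep_apply (d : D) : M.straightStep d = M.rot (M.rot (M.rev d)) := rfl

theorem left_rev (d : D) : M.left (M.rev (M.rot d)) = M.left d := by
  rw [← left_faceStep]
  congr 1
  simp [faceStep, M.rev_rev]

theorem circuitOf_rot_rot (d : D) : M.circuitOf (M.rot (M.rot d)) = M.circuitOf (M.rev d) := by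
  rw [← circuitOf_straightStep (M.rev d), straightStep_apply, M.rev_rev]

section FourValent

variable [Finite D] (h4 : M.IsFourValent)

theorem faceSize_left (d : D) :
    M.faceSize (M.left d) = Function.minimalPeriod M.faceStep d :=
  Equiv.Perm.ncard_sameCycle _ _

include h4

theorem minimalPeriod_rot (d : D) : Function.minimalPeriod M.rot d = 4 := by
  rw [← h4 (M.tail d)]
  exact (Equiv.Perm.ncard_sameCycle _ _).symm

theorem rot_four (d : D) : M.rot (M.rot (M.rot (M.rot d))) = d := by
  have := Function.iterate_minimalPeriod (f := M.rot) (x := d)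
  rwa [minimalPeriod_rot h4] at this

theorem rot_ne (d : D) : M.rot d ≠ d := by
  intro h
  have := Function.IsPeriodicPt.minimalPeriod_le (f := M.rot) (x := d) one_pos h
  rw [minimalPeriod_rot h4] at this
  omega

theorem rot_rot_ne (d : D) : M.rot (M.rot d) ≠ d := by
  intro h
  have := Function.IsPeriodicPt.minimalPeriod_le (f := M.rot) (x := d) two_pos h
  rw [minimalPeriod_rot h4] at this
  omega

theorem rot_rot_rot_ne (d : D) : M.rot (M.rot (M.rot d)) ≠ d := by
  intro h
  apply rot_ne h4 d
  conv_lhs => rw [← h]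
  exact rot_four h4 d

theorem tail_eq_cases {d e : D} (h : M.tail d = M.tail e) :
    d = e ∨ d = M.rot e ∨ d = M.rot (M.rot e) ∨ d = M.rot (M.rot (M.rot e)) := by
  obtain ⟨n, hn⟩ := (tail_eq_iff.1 h).symm.exists_nat_pow_eq
  rw [← Equiv.Perm.iterate_eq_pow] at hn
  have h2 := Function.iterate_mod_minimalPeriod_eq (f := M.rot) (x := e) (n := n)
  rw [minimalPeriod_rot h4, hn] at h2
  have h3 : n % 4 < 4 := Nat.mod_lt _ (by norm_num)
  interval_cases n % 4 <;> simp_all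

theorem straightStep_rev_straightStep (d : D) :
    M.straightStep (M.rev (M.straightStep d)) = M.rev d := by
  rw [straightStep_apply, straightStep_apply, M.rev_rev, rot_four h4]

/-- A straight walk traversed backwards is again straight. -/
theorem rev_pow_straightStep (n : ℕ) (d : D) :
    (M.straightStep ^ n) (M.rev ((M.straightStep ^ n) d)) = M.rev d := by
  induction n with
  | zero => rfl
  | succ n ih =>
    rw [pow_succ, Equiv.Perm.mul_apply, ← pow_succ, pow_succ', Equiv.Perm.mul_apply,
      straightStep_rev_straightStep h4, ih]

theorem circuitOf_rev {d e : D} (h : M.circuitOf d = M.circuitOf e) :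
    M.circuitOf (M.rev d) = M.circuitOf (M.rev e) := by
  obtain ⟨n, hn⟩ := (circuitOf_eq_iff.1 h).exists_nat_pow_eq
  refine (circuitOf_eq_iff.2 ⟨n, ?_⟩).symm
  rw [← hn]
  exact rev_pow_straightStep h4 n d

/-- A circuit containing its own reversal would have to turn back at the middle of the walk from `d`
to `M.rev d`: inside an edge if the length is even, at a vertex if it is odd. -/
theorem circuitOf_rev_ne (d : D) : M.circuitOf (M.rev d) ≠ M.circuitOf d := by
  intro h
  obtain ⟨n, hn⟩ := (circuitOf_eq_iff.1 h.symm).exists_nat_pow_eq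
  obtain ⟨k, rfl | rfl⟩ := Nat.even_or_odd' n
  · have h1 := rev_pow_straightStep h4 k d
    rw [← hn, two_mul, pow_add, Equiv.Perm.mul_apply] at h1
    exact M.rev_ne _ ((M.straightStep ^ k).injective h1)
  · have h1 := rev_pow_straightStep h4 k d
    rw [← hn, two_mul, add_assoc, pow_add, Equiv.Perm.mul_apply] at h1
    have h2 := (M.straightStep ^ k).injective h1
    rw [pow_succ', Equiv.Perm.mul_apply, straightStep_apply] at h2
    exact rot_rot_ne h4 _ h2.symm

theorem circuitOf_rot_rot_ne (d : D) : M.circuitOf (M.rot (M.rot d)) ≠ M.circuitOf d := by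
  rw [circuitOf_rot_rot]
  exact circuitOf_rev_ne h4 d

/-- Opposite darts at a vertex lie on mutually reversed circuits, which differ, so only neighbouring
darts can share a directed circuit. -/
theorem exists_rot_of_selfIntersects {C : M.CentralCircuit} (hC : C.SelfIntersects) :
    ∃ d, M.circuitOf d = M.circuitOf (M.rot d) := by
  obtain ⟨d, e, rfl, he, hne, ht⟩ := hC
  rcases tail_eq_cases h4 ht with h | h | h | h
  · exact absurd h hne
  · exact ⟨e, by rw [← h, he]⟩
  · exact absurd (by rw [← h, he]) (circuitOf_rot_rot_ne h4 e)
  · refine ⟨d, ?_⟩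
    rw [← he, h, rot_four h4]

theorem selfIntersects_of_rot {d : D} (h : M.circuitOf d = M.circuitOf (M.rot d)) :
    (M.circuitOf d).SelfIntersects :=
  ⟨d, M.rot d, rfl, h.symm, (rot_ne h4 d).symm, (tail_rot d).symm⟩

end FourValent

/-! ### The ladder of quadrilaterals at a digon -/

theorem rev_rot_eq_of_faceStep_eq {c d : D} (h : M.faceStep c = d) : M.rev (M.rot d) = c := by
  rw [← h, rot_faceStep, M.rev_rev]

/-- Cross the face to the left of a dart to the edge two steps further along its boundary: in a
quadrilateral this is the opposite edge. -/
def acrossStep (M : CombMap D) : Equiv.Perm D := M.rev * (M.faceStep * M.faceStep)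

theorem acrossStep_apply (d : D) : M.acrossStep d = M.rev (M.faceStep (M.faceStep d)) := rfl

theorem acrossStep_pow_succ (k : ℕ) (d : D) :
    (M.acrossStep ^ (k + 1)) d =
      M.rev (M.faceStep (M.faceStep ((M.acrossStep ^ k) d))) := by
  rw [pow_succ', Equiv.Perm.mul_apply, acrossStep_apply]

/-- Crossing a quadrilateral can be undone from its other side, so a ladder that reaches its first
rung reversed retraces all its rungs. -/
theorem ladder_reversal {a b : D} {k : ℕ}
    (hN : ∀ j < k, M.faceStep (M.faceStep (M.faceStep (M.faceStep ((M.acrossStep ^ j) a)))) =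
      (M.acrossStep ^ j) a) (hab : M.rev a = b) (hk : (M.acrossStep ^ k) a = b) (j m : ℕ)
    (hjm : j + m = k) : (M.acrossStep ^ m) a = M.rev ((M.acrossStep ^ j) a) := by
  induction j generalizing m with
  | zero =>
    obtain rfl : m = k := by omega
    rw [hk, pow_zero, Equiv.Perm.one_apply, hab]
  | succ j ih =>
    have h1 := ih (m + 1) (by omega)
    rw [acrossStep_pow_succ] at h1
    have h2 := M.rev.injective h1
    rw [acrossStep_pow_succ, M.rev_rev, ← h2, hN m (by omega)]

section Ladder

variable [Finite D] (h4 : M.IsFourValent)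
include h4

theorem circuitOf_faceStep_ne (hs : ∀ C : M.CentralCircuit, ¬ C.SelfIntersects) (d : D) :
    M.circuitOf (M.faceStep d) ≠ M.circuitOf d := by
  intro h
  have h1 : M.straightStep d = M.rot (M.rot (M.rot (M.faceStep d))) := by
    rw [straightStep_apply, rot_faceStep]
  refine hs _ (selfIntersects_of_rot h4 (d := M.straightStep d) ?_)
  rw [circuitOf_straightStep, h1, rot_four h4, h]

theorem exists_selfIntersects_of_unique_digon {a : D} (ha : M.faceStep (M.faceStep a) = a)
    (huniq : ∀ d, M.faceStep (M.faceStep d) = d → d = a ∨ d = M.faceStep a)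
    (hface : ∀ d, M.faceStep (M.faceStep d) = d ∨ M.faceStep (M.faceStep (M.faceStep d)) = d ∨
      M.faceStep (M.faceStep (M.faceStep (M.faceStep d))) = d) :
    ∃ C : M.CentralCircuit, C.SelfIntersects := by
  by_contra! hs
  set c : ℕ → D := fun k => (M.acrossStep ^ k) (M.rot a) with hc
  have hc0 : c 0 = M.rot a := rfl
  have hcs (k : ℕ) : c (k + 1) = M.rev (M.faceStep (M.faceStep (c k))) :=
    acrossStep_pow_succ _ _
  -- The first rung is a digon edge seen from outside; the ladder starts in the face beyond it.
  have hrev : M.rev (M.rot a) = M.faceStep a := rev_rot_eq_of_faceStep_eq ha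
  have key (k : ℕ) : (M.circuitOf (M.faceStep (c k)) = M.circuitOf a ∧
      M.circuitOf (M.rot (c k)) = M.circuitOf (M.rev a)) ∧
      M.faceStep (M.faceStep (c k)) ≠ c k ∧
      M.faceStep (M.faceStep (M.faceStep (M.faceStep (c k)))) = c k := by
    induction k using Nat.strong_induction_on with
    | _ k ih =>
    -- Both sides of the ladder stay on the circuit of `a`, prolonged forwards on one side and
    -- backwards on the other.
    have rails : M.circuitOf (M.faceStep (c k)) = M.circuitOf a ∧
        M.circuitOf (M.rot (c k)) = M.circuitOf (M.rev a) := by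
      cases k with
      | zero =>
        rw [hc0]
        refine ⟨?_, circuitOf_rot_rot a⟩
        rw [← circuitOf_straightStep a, straightStep_apply, ← rot_faceStep]
        congr 1
        apply M.rot.injective
        rw [rot_faceStep, hrev, rot_four h4]
      | succ k =>
        obtain ⟨⟨h1, h2⟩, -, h3⟩ := ih k (by omega)
        constructor
        · rw [← h1, ← circuitOf_straightStep (M.faceStep (c k)), straightStep_apply,
            ← rot_faceStep, hcs]
          congr 1
          apply M.rot.injective
          rw [rot_faceStep, M.rev_rev, rot_four h4]
        · rw [← h2, ← circuitOf_straightStep (M.rot (c k)), straightStep_apply, hcs,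
            rev_rot_eq_of_faceStep_eq h3, rot_faceStep]
    refine ⟨rails, ?_⟩
    by_cases hd : M.faceStep (M.faceStep (c k)) = c k
    · exfalso
      rcases huniq _ hd with h | h
      · exact circuitOf_faceStep_ne h4 hs a (h ▸ rails.1)
      -- The ladder would be its own reversal. Its middle is then a rung equal to its reverse (`k`
      -- even) or an earlier face that is a digon (`k` odd).
      · have hr := ladder_reversal (fun j hj => (ih j hj).2.2) hrev h
        obtain ⟨j, hj | hj⟩ := Nat.even_or_odd' k
        · exact M.rev_ne _ (hr j j (by omega)).symm
        · have h1 := hr j (j + 1) (by omega)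
          rw [acrossStep_pow_succ] at h1
          exact (ih j (by omega)).2.1 (M.rev.injective h1)
    · refine ⟨hd, ?_⟩
      rcases hface (c k) with h | h | h
      · exact absurd h hd
      · exfalso
        -- In a triangle the rails meet: two consecutive boundary darts both lie on the circuit of
        -- `a`.
        apply circuitOf_faceStep_ne h4 hs (M.faceStep (c k))
        rw [rails.1, ← rev_rot_eq_of_faceStep_eq h, circuitOf_rev h4 rails.2, M.rev_rev]
      · exact h
  -- `acrossStep` has finite order, so the first rung recurs; the face crossed just before is then
  -- the digon, though `key` makes it a quadrilateral.
  obtain ⟨m, hm⟩ := Nat.exists_eq_succ_of_ne_zero (orderOf_pos M.acrossStep).ne'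
  have h1 : c (m + 1) = M.rot a := by
    simp only [hc]
    rw [← Nat.succ_eq_add_one, ← hm, pow_orderOf_eq_one, Equiv.Perm.one_apply]
  rw [hcs] at h1
  have h2 : M.faceStep (M.faceStep (c m)) = M.faceStep a := by
    rw [← hrev, ← h1, M.rev_rev]
  obtain ⟨-, h3, h4'⟩ := key m
  rw [h2, ha, ← h2] at h4'
  exact h3 h4'

end Ladder

theorem faceStep_cases_of_faceSize {d : D} [Finite D]
    (h : M.faceSize (M.left d) ∈ ({2, 3, 4} : Set ℕ)) :
    M.faceStep (M.faceStep d) = d ∨ M.faceStep (M.faceStep (M.faceStep d)) = d ∨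
      M.faceStep (M.faceStep (M.faceStep (M.faceStep d))) = d := by
  have h1 := Function.iterate_minimalPeriod (f := M.faceStep) (x := d)
  rw [← faceSize_left] at h1
  rcases h with h | h | h <;> rw [h] at h1
  · exact Or.inl h1
  · exact Or.inr (Or.inl h1)
  · exact Or.inr (Or.inr h1)

theorem IsHedrite.exists_selfIntersects (h : M.IsHedrite 7) :
    ∃ C : M.CentralCircuit, C.SelfIntersects := by
  have := h.plane.finite
  have hp : M.p 2 = 1 := by have := h.p_two; omega
  rw [p, Nat.card_eq_one_iff_unique] at hp
  obtain ⟨hsub, ⟨f, hf⟩⟩ := hp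
  induction f using Quotient.inductionOn with | _ a =>
  change M.faceSize (M.left a) = 2 at hf
  have hperiod := (faceSize_left (M := M) a).symm.trans hf
  have ha : M.faceStep (M.faceStep a) = a := by
    have := Function.iterate_minimalPeriod (f := M.faceStep) (x := a)
    rwa [hperiod] at this
  refine exists_selfIntersects_of_unique_digon h.fourValent ha (fun d hd => ?_)
    (fun d => faceStep_cases_of_faceSize (h.faceSize_mem _))
  have hd2 : M.faceSize (M.left d) = 2 := by
    have h1 : M.faceSize (M.left d) ≤ 2 := by
      rw [faceSize_left]
      exact Function.IsPeriodicPt.minimalPeriod_le two_pos hd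
    have h2 := h.faceSize_mem (M.left d)
    simp only [Set.mem_insert_iff, Set.mem_singleton_iff] at h2
    omega
  have hl : M.left d = M.left a :=
    congrArg Subtype.val (hsub.elim ⟨M.left d, hd2⟩ ⟨M.left a, hf⟩)
  obtain ⟨n, hn⟩ := (left_eq_iff.1 hl.symm).exists_nat_pow_eq
  rw [← Equiv.Perm.iterate_eq_pow] at hn
  have h2 := Function.iterate_mod_minimalPeriod_eq (f := M.faceStep) (x := a) (n := n)
  rw [hperiod, hn] at h2
  rcases Nat.mod_two_eq_zero_or_one n with h0 | h0 <;> rw [h0] at h2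
  · exact Or.inl h2.symm
  · exact Or.inr h2.symm

end CombMap

theorem ZMod.add_eq_zero_iff_of_two {a b : ZMod 2} : a + b = 0 ↔ a = b := by
  revert a b; decide

/-! ### Cycles and boundaries modulo 2 on the sphere -/

namespace CombMap

section Incidence

variable {D T E : Type*} [Fintype D]

open Classical in
/-- The incidence matrix over `ZMod 2` of the relation traced out by two maps on a set of darts. -/
noncomputable def incidence (t : D → T) (s : D → E) : Matrix T E (ZMod 2) :=
  Matrix.of fun v e => ∑ d, if t d = v ∧ s d = e then 1 else 0

open Classical in
theorem incidence_transpose (t : D → T) (s : D → E) :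
    (incidence t s).transpose = incidence s t := by
  ext e v
  exact Finset.sum_congr rfl fun _ _ => if_congr and_comm rfl rfl

open Classical in
theorem incidence_mulVec [Fintype E] (t : D → T) (s : D → E) (x : E → ZMod 2) (v : T) :
    (incidence t s).mulVec x v = ∑ d, if t d = v then x (s d) else 0 := by
  simp only [incidence, Matrix.mulVec, dotProduct, Matrix.of_apply, Finset.sum_mul]
  rw [Finset.sum_comm]
  refine Finset.sum_congr rfl fun d _ => ?_
  by_cases h : t d = v <;> simp [h]

theorem incidence_mulVec_pair [Fintype T] (t : D → T) (s : D → E) (g : T → ZMod 2) {d d' : D}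
    (hne : d ≠ d') (hs : ∀ e, s e = s d ↔ e = d ∨ e = d') :
    (incidence s t).mulVec g (s d) = g (t d) + g (t d') := by
  classical
  rw [incidence_mulVec, ← Finset.sum_filter, ← Finset.sum_pair (f := fun e => g (t e)) hne]
  congr 1
  ext e
  simp [hs]

/-- By connectedness the kernel consists of the constants. This serves for both vertices and faces
against edges. -/
theorem rank_incidence_add_one [Fintype T] [Nonempty T] (t : D → T) (s : D → E)
    (hs : Function.Surjective s) (v : D → D) (hv : ∀ d, v d ≠ d)
    (hsv : ∀ d e, s e = s d ↔ e = d ∨ e = v d)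
    (hconn : ∀ g : T → ZMod 2, (∀ d, g (t d) = g (t (v d))) → ∃ c, ∀ i, g i = c) :
    (incidence s t).rank + 1 = Fintype.card T := by
  have hker : LinearMap.ker (incidence s t).mulVecLin =
      Submodule.span (ZMod 2) {(1 : T → ZMod 2)} := by
    ext g
    rw [LinearMap.mem_ker, Matrix.mulVecLin_apply, Submodule.mem_span_singleton]
    constructor
    · intro h
      obtain ⟨c, hc⟩ := hconn g fun d => by
        rw [← ZMod.add_eq_zero_iff_of_two, ← incidence_mulVec_pair t s g (hv d).symm (hsv d), h]
        rfl
      exact ⟨c, by ext i; simp [hc]⟩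
    · rintro ⟨c, rfl⟩
      ext e
      obtain ⟨d, rfl⟩ := hs e
      rw [incidence_mulVec_pair t s _ (hv d).symm (hsv d)]
      exact ZMod.add_eq_zero_iff_of_two.2 rfl
  have h := LinearMap.finrank_range_add_finrank_ker (incidence s t).mulVecLin
  rw [hker, finrank_span_singleton one_ne_zero, Module.finrank_fintype_fun_eq_card] at h
  exact h

end Incidence

variable {D : Type*} {M : CombMap D}

/-- The edge of a dart. -/
def edgeOf (M : CombMap D) (d : D) : M.Edge := Quotient.mk _ d

theorem edgeOf_eq_iff {d e : D} : M.edgeOf e = M.edgeOf d ↔ e = d ∨ e = M.rev d := by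
  refine Quotient.eq.trans ⟨fun h => ?_, ?_⟩
  · obtain ⟨i, hi⟩ := Equiv.Perm.SameCycle.symm h
    have hsq : M.rev ^ (2 : ℤ) = 1 := by
      ext d
      exact M.rev_rev d
    obtain ⟨k, rfl | rfl⟩ := Int.even_or_odd' i
    · rw [zpow_mul, hsq, one_zpow] at hi
      exact Or.inl hi.symm
    · rw [zpow_add, zpow_mul, hsq, one_zpow] at hi
      exact Or.inr hi.symm
  · rintro (rfl | rfl)
    · exact Equiv.Perm.SameCycle.refl _ _
    · exact Equiv.Perm.sameCycle_apply_left.2 (Equiv.Perm.SameCycle.refl _ _)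

theorem edgeOf_surjective : Function.Surjective M.edgeOf := Quotient.mk_surjective

theorem tail_surjective : Function.Surjective M.tail := Quotient.mk_surjective

theorem left_surjective : Function.Surjective M.left := Quotient.mk_surjective

theorem IsConnected.eq_of_invariant {α : Type*} (h : M.IsConnected) {g : D → α}
    (hrot : ∀ d, g (M.rot d) = g d) (hrev : ∀ d, g (M.rev d) = g d) (d e : D) : g d = g e := by
  obtain ⟨⟨σ, hσ⟩, rfl⟩ := h.exists_smul_eq d e
  change g d = g (σ d)
  induction hσ using Subgroup.closure_induction generalizing d with
  | mem τ hτ =>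
    rcases hτ with rfl | rfl
    · exact (hrot d).symm
    · exact (hrev d).symm
  | one => rfl
  | mul σ τ _ _ h1 h2 => exact (h2 d).trans (h1 (τ d))
  | inv σ _ h1 => simpa using (h1 (σ⁻¹ d)).symm

theorem IsConnected.tail_const (h : M.IsConnected) [Nonempty D] (g : M.Vertex → ZMod 2)
    (hg : ∀ d, g (M.tail d) = g (M.tail (M.rev d))) : ∃ c, ∀ v, g v = c := by
  refine ⟨g (M.tail (Classical.arbitrary D)), fun v => ?_⟩
  obtain ⟨d, rfl⟩ := tail_surjective v
  exact h.eq_of_invariant (g := fun d => g (M.tail d)) (fun d => by rw [tail_rot])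
    (fun d => (hg d).symm) _ _

theorem IsConnected.left_const (h : M.IsConnected) [Nonempty D] (g : M.Face → ZMod 2)
    (hg : ∀ d, g (M.left d) = g (M.left (M.rev d))) : ∃ c, ∀ f, g f = c := by
  refine ⟨g (M.left (Classical.arbitrary D)), fun f => ?_⟩
  obtain ⟨d, rfl⟩ := left_surjective f
  exact h.eq_of_invariant (g := fun d => g (M.left d))
    (fun d => by rw [hg, left_rev]) (fun d => (hg d).symm) _ _

instance [Finite D] : Finite M.Vertex := Quotient.finite _
instance [Finite D] : Finite M.Edge := Quotient.finite _
instance [Finite D] : Finite M.Face := Quotient.finite _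

open Classical in
/-- On the sphere every cycle modulo `2` is the boundary of a set of faces. -/
theorem IsPlane.exists_potential [Fintype D] [Nonempty D] (h : M.IsPlane) (x : M.Edge → ZMod 2)
    (hx : ∀ v, (∑ d, if M.tail d = v then x (M.edgeOf d) else 0) = 0) :
    ∃ f : M.Face → ZMod 2, ∀ d, f (M.left d) + f (M.left (M.rev d)) = x (M.edgeOf d) := by
  have := Fintype.ofFinite M.Vertex
  have := Fintype.ofFinite M.Edge
  have := Fintype.ofFinite M.Face
  have : Nonempty M.Vertex := ⟨M.tail (Classical.arbitrary D)⟩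
  have : Nonempty M.Face := ⟨M.left (Classical.arbitrary D)⟩
  have hV := rank_incidence_add_one M.tail M.edgeOf edgeOf_surjective M.rev M.rev_ne
    (fun _ _ => edgeOf_eq_iff) h.connected.tail_const
  have hF := rank_incidence_add_one M.left M.edgeOf edgeOf_surjective M.rev M.rev_ne
    (fun _ _ => edgeOf_eq_iff) h.connected.left_const
  rw [← incidence_transpose, Matrix.rank_transpose] at hV
  have hle : LinearMap.range (incidence M.edgeOf M.left).mulVecLin ≤
      LinearMap.ker (incidence M.tail M.edgeOf).mulVecLin := by
    rintro _ ⟨f, rfl⟩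
    rw [LinearMap.mem_ker]
    ext v
    simp only [Matrix.mulVecLin_apply, Pi.zero_apply]
    rw [incidence_mulVec]
    simp only [incidence_mulVec_pair M.left M.edgeOf f (M.rev_ne _).symm
      (fun _ => edgeOf_eq_iff)]
    simp only [← Finset.sum_filter]
    rw [Finset.sum_add_distrib, ZMod.add_eq_zero_iff_of_two]
    symm
    -- The face to the right of a dart is the one to the left of its clockwise neighbour, so each
    -- corner at `v` is counted twice.
    refine Finset.sum_bij' (fun d _ => M.rot⁻¹ d) (fun d _ => M.rot d) ?_ ?_ ?_ ?_ ?_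
    · intro d hd
      rw [Finset.mem_filter] at hd ⊢
      refine ⟨Finset.mem_univ _, ?_⟩
      rw [← tail_rot]
      simpa using hd.2
    · intro d hd
      rw [Finset.mem_filter] at hd ⊢
      exact ⟨Finset.mem_univ _, by rw [tail_rot, hd.2]⟩
    · simp
    · simp
    · intro d _
      rw [← left_rev (M.rot⁻¹ d)]
      simp
  have hker := LinearMap.finrank_range_add_finrank_ker (incidence M.tail M.edgeOf).mulVecLin
  rw [Module.finrank_fintype_fun_eq_card] at hker
  have heuler := h.euler
  simp only [Nat.card_eq_fintype_card] at heuler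
  -- By Euler's formula the cycle space has dimension E - (V - 1) = F - 1, the rank of the boundary
  -- map.
  have heq := Submodule.eq_of_le_of_finrank_eq hle (by
    simp only [Matrix.rank] at hV hF
    omega)
  have hmem : x ∈ LinearMap.ker (incidence M.tail M.edgeOf).mulVecLin := by
    rw [LinearMap.mem_ker]
    ext v
    rw [Matrix.mulVecLin_apply, incidence_mulVec, hx]
    rfl
  rw [← heq] at hmem
  obtain ⟨f, hf⟩ := hmem
  refine ⟨f, fun d => ?_⟩
  rw [← hf, Matrix.mulVecLin_apply,
    incidence_mulVec_pair M.left M.edgeOf f (M.rev_ne _).symm (fun _ => edgeOf_eq_iff)]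

/-! ### The parity count for even faces -/

theorem sum_eq_sum_of_sum_rot_eq [Fintype D] (h4 : M.IsFourValent) {R : Type*} [AddCommMonoid R]
    {F G : D → R} (h : ∀ v, ∃ a, M.tail a = v ∧
      F a + (F (M.rot a) + (F (M.rot (M.rot a)) + F (M.rot (M.rot (M.rot a))))) =
        G a + (G (M.rot a) + (G (M.rot (M.rot a)) + G (M.rot (M.rot (M.rot a)))))) :
    ∑ d, F d = ∑ d, G d := by
  classical
  have := Fintype.ofFinite M.Vertex
  rw [← Finset.sum_fiberwise _ M.tail F, ← Finset.sum_fiberwise _ M.tail G]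
  refine Finset.sum_congr rfl fun v _ => ?_
  obtain ⟨a, rfl, ha⟩ := h v
  have hfib : (Finset.univ.filter fun d => M.tail d = M.tail a) =
      {a, M.rot a, M.rot (M.rot a), M.rot (M.rot (M.rot a))} := by
    ext d
    simp only [Finset.mem_filter, Finset.mem_univ, true_and, Finset.mem_insert,
      Finset.mem_singleton]
    constructor
    · exact tail_eq_cases h4
    · rintro (rfl | rfl | rfl | rfl) <;> simp only [tail_rot]
  have hsum (H : D → R) : ∑ d with M.tail d = M.tail a, H d =
      H a + (H (M.rot a) + (H (M.rot (M.rot a)) + H (M.rot (M.rot (M.rot a))))) := by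
    rw [hfib, Finset.sum_insert, Finset.sum_insert, Finset.sum_insert, Finset.sum_singleton]
    · simpa using (rot_ne h4 _).symm
    · simpa using ⟨(rot_ne h4 a).symm, (rot_rot_ne h4 a).symm⟩
    · simpa using ⟨(rot_ne h4 a).symm, (rot_rot_ne h4 a).symm, (rot_rot_rot_ne h4 a).symm⟩
  rw [hsum, hsum, ha]

theorem sum_left_eq_zero [Fintype D] (he : M.AllFacesEven) (f : M.Face → ZMod 2) :
    ∑ d, f (M.left d) = 0 := by
  classical
  have := Fintype.ofFinite M.Face
  rw [← Finset.sum_fiberwise _ M.left]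
  refine Finset.sum_eq_zero fun g _ => ?_
  rw [Finset.sum_congr rfl (g := fun _ => f g)
    (fun d hd => by rw [(Finset.mem_filter.1 hd).2]), Finset.sum_const]
  have h1 : (Finset.univ.filter fun d => M.left d = g).card = M.faceSize g := by
    rw [faceSize, ← Set.ncard_coe_finset]
    simp
  rw [h1, nsmul_eq_mul, (ZMod.natCast_eq_zero_iff_even).2 (he g), zero_mul]

theorem sum_range_add_succ (g : ℕ → ZMod 2) (n : ℕ) :
    ∑ i ∈ Finset.range n, (g i + g (i + 1)) = g 0 + g n := by
  induction n with
  | zero => exact (ZMod.add_eq_zero_iff_of_two.2 rfl).symm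
  | succ n ih =>
    rw [Finset.sum_range_succ, ih, add_assoc, ← add_assoc (g n),
      ZMod.add_eq_zero_iff_of_two.2 rfl, zero_add]

/-- Here `wᵢ` marks the chosen faces around a vertex and `mᵢ` the passages leaving along each dart.
Opposite edges are used equally often, which leaves three free bits to check. -/
theorem corner_sum_straight (w₀ w₁ w₂ w₃ m₀ m₁ m₂ m₃ : ZMod 2) (h₀ : w₀ + w₃ = m₀ + m₂)
    (h₁ : w₁ + w₀ = m₁ + m₃) (h₂ : w₂ + w₁ = m₂ + m₀) :
    (1 + (m₀ + m₂)) * w₀ + ((1 + (m₁ + m₃)) * w₁ + ((1 + (m₂ + m₀)) * w₂ +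
      (1 + (m₃ + m₁)) * w₃)) = m₀ + (m₁ + (m₂ + m₃)) := by
  obtain rfl : w₁ = m₁ + m₃ - w₀ := by rw [← h₁]; ring
  obtain rfl : w₃ = m₀ + m₂ - w₀ := by rw [← h₀]; ring
  obtain rfl : w₂ = m₂ + m₀ - (m₁ + m₃ - w₀) := by rw [← h₂]; ring
  clear h₀ h₁ h₂
  generalize hA : m₀ + m₂ = A
  generalize hB : m₁ + m₃ = B
  rw [show m₀ + (m₁ + (m₂ + m₃)) = A + B by rw [← hA, ← hB]; ring, add_comm m₂, add_comm m₃,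
    hA, hB]
  clear hA hB
  revert A B w₀
  decide

/-- At the corner the stretch uses darts 0 and 3, so the two unused darts have the same `w` and
cancel. -/
theorem corner_sum_turn (w₀ w₁ w₂ w₃ : ZMod 2) (h₁ : w₁ + w₀ = 0) (h₂ : w₂ + w₁ = 0) :
    (1 + 1) * w₀ + ((1 + 0) * w₁ + ((1 + 0) * w₂ + (1 + 1) * w₃)) = 0 := by
  revert w₀ w₁ w₂ w₃
  decide

open Classical in
theorem circuitOf_rot_ne [Fintype D] (hp : M.IsPlane) (h4 : M.IsFourValent)
    (he : M.AllFacesEven) (d : D) : M.circuitOf d ≠ M.circuitOf (M.rot d) := by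
  intro hd
  have : Nonempty D := ⟨d⟩
  have hex := (circuitOf_eq_iff.1 hd).exists_nat_pow_eq
  -- Minimality makes the darts of the stretch distinct. The stretch may still cross itself at other
  -- vertices.
  obtain ⟨n, hn, hmin⟩ : ∃ n, (M.straightStep ^ n) d = M.rot d ∧
      ∀ i < n, (M.straightStep ^ i) d ≠ M.rot d :=
    ⟨Nat.find hex, Nat.find_spec hex, fun i hi => Nat.find_min hex hi⟩
  set c : ℕ → D := fun i => (M.straightStep ^ i) d with hc
  have hc0 : c 0 = d := rfl
  have hcs (i : ℕ) : c (i + 1) = M.straightStep (c i) := by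
    simp only [hc, pow_succ', Equiv.Perm.mul_apply]
  have hcirc (i : ℕ) : M.circuitOf (c i) = M.circuitOf d := by
    induction i with
    | zero => rfl
    | succ i ih => rw [hcs, circuitOf_straightStep, ih]
  have hlt {i j : ℕ} (hij : i < j) (hj : j ≤ n) : c i ≠ c j := by
    intro h
    refine hmin (n - j + i) (by omega) ?_
    rw [pow_add, Equiv.Perm.mul_apply]
    change (M.straightStep ^ (n - j)) (c i) = _
    rw [h, ← hn, ← Equiv.Perm.mul_apply, ← pow_add, Nat.sub_add_cancel hj]
  have hinj {i j : ℕ} (hi : i ≤ n) (hj : j ≤ n) : c i = c j ↔ i = j := by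
    refine ⟨fun h => ?_, fun h => h ▸ rfl⟩
    rcases lt_trichotomy i j with hij | hij | hij
    · exact absurd h (hlt hij hj)
    · exact hij
    · exact absurd h.symm (hlt hij hi)
  have hrevne (i j : ℕ) : c i ≠ M.rev (c j) := by
    intro h
    apply circuitOf_rev_ne h4 (c j)
    rw [← h, hcirc, hcirc]
  obtain ⟨N, rfl⟩ : ∃ N, n = N + 1 := by
    refine Nat.exists_eq_succ_of_ne_zero ?_
    rintro rfl
    exact rot_ne h4 d hn.symm
  have hcn : c (N + 1) = M.rot d := hn
  set x : M.Edge → ZMod 2 := fun e =>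
    ∑ i ∈ Finset.range (N + 1), if M.edgeOf (c i) = e then 1 else 0
  have hy (a : D) : x (M.edgeOf a) = ∑ i ∈ Finset.range (N + 1),
      ((if c i = a then 1 else 0) + if M.rev (c i) = a then 1 else 0) := by
    refine Finset.sum_congr rfl fun i _ => ?_
    by_cases h1 : c i = a
    · have h2 : M.rev (c i) ≠ a := by rw [← h1]; exact M.rev_ne _
      rw [if_pos (by rw [h1]), if_pos h1, if_neg h2, add_zero]
    · rw [if_neg h1, zero_add]
      refine if_congr ?_ rfl rfl
      rw [edgeOf_eq_iff, or_iff_right h1]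
      exact ⟨fun h => by rw [h, M.rev_rev], fun h => by rw [← h, M.rev_rev]⟩
  have hsum (F : D → ZMod 2) : ∑ a, x (M.edgeOf a) * F a =
      ∑ i ∈ Finset.range (N + 1), (F (c i) + F (M.rev (c i))) := by
    simp only [hy, Finset.sum_mul]
    rw [Finset.sum_comm]
    refine Finset.sum_congr rfl fun i _ => ?_
    simp [add_mul, Finset.sum_add_distrib]
  have htail (i : ℕ) : M.tail (M.rev (c i)) = M.tail (c (i + 1)) := by
    rw [hcs, straightStep_apply, tail_rot, tail_rot]
  have hcycle (v : M.Vertex) :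
      (∑ a, if M.tail a = v then x (M.edgeOf a) else 0) = 0 := by
    have h1 := hsum fun a => if M.tail a = v then 1 else 0
    simp only [mul_ite, mul_one, mul_zero, htail] at h1
    rw [h1, sum_range_add_succ (fun i => if M.tail (c i) = v then (1 : ZMod 2) else 0),
      ZMod.add_eq_zero_iff_of_two]
    simp only [hcn, hc0, tail_rot]
  obtain ⟨f, hf⟩ := hp.exists_potential x hcycle
  set w : D → ZMod 2 := fun a => f (M.left a) with hw
  set y : D → ZMod 2 := fun a => x (M.edgeOf a) with hydef
  have hwrev (a : D) : w a + w (M.rev a) = y a := hf a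
  have hwrot (a : D) : w (M.rot a) + w a = y (M.rot a) := by
    rw [← hwrev]
    simp only [hw, left_rev]
  have hyrev (a : D) : y (M.rev a) = y a := by
    simp only [hydef]
    congr 1
    exact edgeOf_eq_iff.2 (Or.inr rfl)
  -- Only `c 1`, ..., `c N` count as straight passages; the start `c 0` and the end `c (N + 1)` form
  -- the corner and enter `hym` separately.
  set m : D → ZMod 2 := fun a => ∑ i ∈ Finset.range N, if c (i + 1) = a then 1 else 0 with hm
  have hym (a : D) : y a = (m a + if d = a then 1 else 0) +
      (m (M.rot (M.rot a)) + if M.rot d = M.rot (M.rot a) then 1 else 0) := by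
    have h1 (i : ℕ) : (M.rev (c i) = a) ↔ c (i + 1) = M.rot (M.rot a) := by
      rw [hcs, straightStep_apply, M.rot.injective.eq_iff, M.rot.injective.eq_iff]
    simp only [hydef, hy, h1]
    rw [Finset.sum_add_distrib, Finset.sum_range_succ', Finset.sum_range_succ, hcn, hc0]
  have hm0 (a : D) (ha : ∀ i < N, c (i + 1) ≠ a) : m a = 0 :=
    Finset.sum_eq_zero fun i hi => if_neg (ha i (Finset.mem_range.1 hi))
  have hW : ∑ a, w a = 0 := sum_left_eq_zero he f
  have hYW : ∑ a, y a * w a = N + 1 := by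
    rw [hsum]
    have h1 : ∀ i ∈ Finset.range (N + 1), w (c i) + w (M.rev (c i)) = 1 := by
      intro i hi
      have hi' := Finset.mem_range.1 hi
      rw [hwrev]
      simp only [hydef, hy]
      rw [Finset.sum_eq_single i]
      · rw [if_pos rfl, if_neg (M.rev_ne _), add_zero]
      · intro j hj hji
        have hj' := Finset.mem_range.1 hj
        rw [if_neg (fun h => hji ((hinj hj'.le hi'.le).1 h)),
          if_neg (hrevne i j).symm, add_zero]
      · exact fun h => absurd hi h
    rw [Finset.sum_congr rfl h1]
    simp
  -- The two darts of an edge together give `(1 + y) * y = 0`.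
  have hinner : ∑ a, (1 + y a) * w a = 0 := by
    refine Finset.sum_involution (fun a _ => M.rev a) ?_ (fun a _ _ => M.rev_ne a)
      (fun _ _ => Finset.mem_univ _) (fun a _ => M.rev_rev a)
    intro a _
    rw [hyrev, ← mul_add, hwrev]
    generalize y a = z
    revert z
    decide
  have hstraight : ∑ a, (1 + y a) * w a = ∑ a, m a := by
    refine sum_eq_sum_of_sum_rot_eq h4 fun v => ?_
    by_cases hv : M.tail d = v
    · refine ⟨d, hv, ?_⟩
      have e0 : m d = 0 := hm0 _ fun i hi => (hlt (Nat.succ_pos i) (by omega)).symm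
      have e1 : m (M.rot d) = 0 := hm0 _ fun i hi => hmin _ (by omega)
      have e2 : m (M.rot (M.rot d)) = 0 := hm0 _ fun i hi h => by
        apply circuitOf_rot_rot_ne h4 d
        rw [← h, hcirc]
      have e3 : m (M.rot (M.rot (M.rot d))) = 0 := hm0 _ fun i hi h => by
        apply circuitOf_rot_rot_ne h4 (M.rot d)
        rw [← h, hcirc, hd]
      have y0 : y d = 1 := by
        rw [hym, e0, e2, if_pos rfl, if_neg (rot_ne h4 _).symm]; rfl
      have y1 : y (M.rot d) = 0 := by
        rw [hym, e1, e3, if_neg (rot_ne h4 _).symm, if_neg (rot_rot_ne h4 _).symm]; rfl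
      have y2 : y (M.rot (M.rot d)) = 0 := by
        rw [hym, e2, rot_four h4, e0, if_neg (rot_rot_ne h4 _).symm, if_neg (rot_ne h4 _)]; rfl
      have y3 : y (M.rot (M.rot (M.rot d))) = 1 := by
        rw [hym, e3, rot_four h4, e1, if_neg (rot_rot_rot_ne h4 _).symm, if_pos rfl]; rfl
      rw [e0, e1, e2, e3, y0, y1, y2, y3]
      exact corner_sum_turn _ _ _ _ ((hwrot d).trans y1) ((hwrot _).trans y2)
    · obtain ⟨a, rfl⟩ := tail_surjective v
      refine ⟨a, rfl, ?_⟩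
      have hya (b : D) (hb : M.tail b = M.tail a) : y b = m b + m (M.rot (M.rot b)) := by
        rw [hym, if_neg, if_neg, add_zero, add_zero]
        · intro h
          apply hv
          rw [← hb, ← tail_rot d, h, tail_rot, tail_rot]
        · rintro rfl
          exact hv hb
      have y0 := hya a rfl
      have y1 := hya (M.rot a) (tail_rot a)
      have y2 := hya (M.rot (M.rot a)) (by simp only [tail_rot])
      have y3 := hya (M.rot (M.rot (M.rot a))) (by simp only [tail_rot])
      rw [rot_four h4] at y2 y3
      rw [y0, y1, y2, y3]
      refine corner_sum_straight _ _ _ _ _ _ _ _ ?_ ((hwrot _).trans y1) ((hwrot _).trans y2)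
      have h1 := hwrot (M.rot (M.rot (M.rot a)))
      rwa [rot_four h4, y0] at h1
  have hcount : ∑ a, m a = N := by
    simp only [hm]
    rw [Finset.sum_comm]
    simp
  rw [hinner, hcount] at hstraight
  simp only [add_mul, one_mul] at hinner
  rw [Finset.sum_add_distrib, hW, hYW, ← hstraight] at hinner
  exact absurd hinner (by decide)

theorem IsPlane.not_selfIntersects (hp : M.IsPlane) (h4 : M.IsFourValent)
    (he : M.AllFacesEven) (C : M.CentralCircuit) : ¬ C.SelfIntersects := by
  intro hC
  have := hp.finite
  have := Fintype.ofFinite D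
  obtain ⟨d, hd⟩ := exists_rot_of_selfIntersects h4 hC
  exact circuitOf_rot_ne hp h4 he d hd

/-! ### Euler's formula and the faces of a 4-hedrite -/

theorem card_eq_sum_ncard {T : Type*} [Finite D] [Fintype T] (t : D → T) :
    Nat.card D = ∑ v, {d : D | t d = v}.ncard := by
  classical
  have := Fintype.ofFinite D
  rw [Nat.card_eq_fintype_card, ← Finset.card_univ,
    Finset.card_eq_sum_card_fiberwise (f := t) (t := Finset.univ) (by simp)]
  refine Finset.sum_congr rfl fun v _ => ?_
  rw [← Set.ncard_coe_finset]
  simp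

theorem card_eq_two_mul_card_edge [Finite D] : Nat.card D = 2 * Nat.card M.Edge := by
  have := Fintype.ofFinite M.Edge
  rw [card_eq_sum_ncard M.edgeOf, Finset.sum_congr rfl (g := fun _ => 2)]
  · simp [mul_comm]
  · intro e _
    obtain ⟨d, rfl⟩ := edgeOf_surjective e
    rw [← Set.ncard_pair (M.rev_ne d).symm]
    congr 1
    ext e
    simp [edgeOf_eq_iff]

theorem IsFourValent.card_eq [Finite D] (h4 : M.IsFourValent) :
    Nat.card D = 4 * Nat.card M.Vertex := by
  have := Fintype.ofFinite M.Vertex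
  have h : ∀ v ∈ Finset.univ, {d : D | M.tail d = v}.ncard = 4 := fun v _ => h4 v
  rw [card_eq_sum_ncard M.tail, Finset.sum_congr rfl h]
  simp [mul_comm]

theorem IsPlane.sum_four_sub_faceSize [Fintype M.Face] (hp : M.IsPlane) (h4 : M.IsFourValent) :
    ∑ f : M.Face, (4 - (M.faceSize f : ℤ)) = 8 := by
  have := hp.finite
  have h1 : (Nat.card D : ℤ) = ∑ f : M.Face, (M.faceSize f : ℤ) :=
    mod_cast card_eq_sum_ncard M.left
  have h2 := card_eq_two_mul_card_edge (M := M)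
  have h3 := h4.card_eq
  have h5 := hp.euler
  rw [Nat.card_eq_fintype_card (α := M.Face)] at h5
  rw [Finset.sum_sub_distrib, ← h1]
  simp only [Finset.sum_const, Finset.card_univ, nsmul_eq_mul]
  omega

theorem IsHedrite.allFacesEven (h : M.IsHedrite 4) : M.AllFacesEven := by
  classical
  have := h.plane.finite
  have := Fintype.ofFinite M.Face
  have hmem (f : M.Face) : M.faceSize f = 2 ∨ M.faceSize f = 3 ∨ M.faceSize f = 4 := by
    simpa using h.faceSize_mem f
  have hp : (∑ f : M.Face, if M.faceSize f = 2 then (2 : ℤ) else 0) = 8 := by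
    have h1 : M.p 2 = 4 := by have := h.p_two; omega
    rw [p, Nat.card_eq_fintype_card, Fintype.card_subtype] at h1
    rw [← Finset.sum_filter, Finset.sum_const, h1]
    norm_num
  have hs := h.plane.sum_four_sub_faceSize h.fourValent
  -- The four digons already account for the total curvature 8. The remaining terms are nonnegative,
  -- and a triangle would contribute 1.
  have h0 : ∑ f : M.Face, (4 - (M.faceSize f : ℤ) - if M.faceSize f = 2 then (2 : ℤ) else 0) =
      0 := by
    rw [Finset.sum_sub_distrib, hs, hp, sub_self]
  rw [Finset.sum_eq_zero_iff_of_nonneg] at h0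
  · intro f
    have h1 := h0 f (Finset.mem_univ f)
    rcases hmem f with h2 | h2 | h2 <;> rw [h2] at h1 ⊢
    · decide
    · norm_num at h1
    · decide
  · intro f _
    rcases hmem f with h2 | h2 | h2 <;> rw [h2] <;> norm_num

end CombMap

theorem mainTheorem10 :
    (∀ (D : Type*) (M : CombMap D), M.IsPlane → M.IsFourValent → M.AllFacesEven →
      ∀ C : M.CentralCircuit, ¬ C.SelfIntersects) ∧
    (∀ (D : Type*) (M : CombMap D), M.IsHedrite 4 →
      M.AllFacesEven ∧ ∀ C : M.CentralCircuit, ¬ C.SelfIntersects) ∧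
    (∀ (D : Type*) (M : CombMap D), M.IsHedrite 7 →
      ∃ C : M.CentralCircuit, C.SelfIntersects) :=
  ⟨fun _ _ hp h4 he => hp.not_selfIntersects h4 he,
    fun _ _ h => ⟨h.allFacesEven, h.plane.not_selfIntersects h.fourValent h.allFacesEven⟩,
    fun _ _ h => h.exists_selfIntersects⟩
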